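/- Let $(x_n)_{n\in\mathbb N}$ be a sequence in $[0,1]$ and let $k\ge 2$ be an integer. For real $x$ let $((x))\in(-\tfrac12,\tfrac12]$ denote the signed distance of $x$ from the origin modulo $1$, i.e. the unique real number in $(-\tfrac12,\tfrac12]$ that differs from $x$ by an integer. For a closed rectangle $\mathcal R=[a_1,b_1]\times\cdots\times[a_{k-1},b_{k-1}]\subseteq\mathbb R^{k-1}$ and $N\ge 1$ put $$R_k(0;\mathcal R,N)=\frac1{N^k}\,\#\Big\{(i_1,\dots,i_k)\in\{1,\dots,N\}^k \text{ with } i_1,\dots,i_k \text{ pairwise distinct} : \big(((x_{i_1}-x_{i_2})),\dots,((x_{i_1}-x_{i_k}))\big)\in\mathcal R\Big\}.$$ Then the following are equivalent: (i) $(x_n)$ is uniformly distributed mod $1$, that is, $\lim_{N\to\infty}\frac1N\#\{i\le N: x_i\in[a,b]\}=b-a$ for all $0\le a<b\le 1$; (ii) $(x_n)$ has Poissonian $(k,0)$-correlations, that is, $\lim_{N\to\infty}R_k(0;\mathcal R,N)=\lambda(\mathcal R)$ for every closed rectangle $\mathcal R=[a_1,b_1]\times\cdots\times[a_{k-1},b_{k-1}]\subseteq[-\tfrac12,\tfrac12]^{k-1}$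 (with $a_j\le b_j$), where $\lambda$ is the $(k-1)$-dimensional Lebesgue measure. -/

import Mathlib

open Filter Topology MeasureTheory

noncomputable section

/-- The signed distance of `x` from the origin modulo `1`: the representative of `x` modulo `1`
in `(-1/2, 1/2]`. -/
def signedDistModOne (x : ℝ) : ℝ :=
  if Int.fract x ≤ 1 / 2 then Int.fract x else Int.fract x - 1

/-- Uniform distribution of a sequence of points of `[0, 1]` (the first `N` terms of the sequence
are `x 0, …, x (N - 1)`). -/
def UniformlyDistributed (x : ℕ → ℝ) : Prop :=
  ∀ a b : ℝ, 0 ≤ a → a < b → b ≤ 1 →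
    Tendsto (fun N : ℕ => ({i : Fin N | x i ∈ Set.Icc a b}.ncard : ℝ) / (N : ℝ)) atTop
      (𝓝 (b - a))

/-- The `(k, β)`-correlation function `R_k(β; R, N)` of the sequence `x`, for `k ≥ 1`.
The tuples `i = (i 0, …, i (k - 1))` consist of `k` distinct indices among the first `N` ones, and
the coordinates of the vector of differences are `((x (i 0) - x (i (j + 1))))`, `j < k - 1`. -/
def correlation (x : ℕ → ℝ) (k : ℕ) (β : ℝ) (R : Set (Fin (k - 1) → ℝ)) (N : ℕ) : ℝ :=
  ({i : Fin (k - 1 + 1) → Fin N | Function.Injective i ∧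
      (fun j : Fin (k - 1) => (N : ℝ) ^ β * signedDistModOne (x (i 0) - x (i j.succ))) ∈ R}.ncard : ℝ)
    / (N : ℝ) ^ ((k : ℝ) - ((k : ℝ) - 1) * β)

/-- Poissonian `(k, 0)`-correlations: `R_k(0; R, N)` tends to the Lebesgue measure of `R` for every
closed rectangle `R = [a_1, b_1] × ⋯ × [a_{k-1}, b_{k-1}]` inside `[-1/2, 1/2]^{k-1}`. -/
def PoissonianZeroCorrelations (x : ℕ → ℝ) (k : ℕ) : Prop :=
  ∀ a b : Fin (k - 1) → ℝ, (∀ j, a j ≤ b j) → (∀ j, -(1 / 2) ≤ a j) → (∀ j, b j ≤ 1 / 2) →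
    Tendsto (fun N : ℕ => correlation x k 0 (Set.Icc a b) N) atTop
      (𝓝 (volume.real (Set.Icc a b)))

end

/-! Tuples with a repeated index are a vanishing proportion of all $N^k$ tuples, so distinctness can
be dropped. Once $i_1$ is fixed, the conditions on the other indices are independent. The
correlation is therefore asymptotically the mean over $i$ of $\prod_j$ `diffFreq x N (x i) (a j) (b
j)` (`tendsto_correlation_iff`).

If $(x_n)$ is uniformly distributed, each factor tends to $b_j-a_j$ uniformly in the centre
(`UniformlyDistributed.eventually_abs_diffFreq_sub_le`), hence so does the mean of the products to
the volume.

Conversely, letting all sides but one be $[-\tfrac12,\tfrac12]$ reduces to $k=2$: the differences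
$((x_i-x_l))$ equidistribute. Integrating the character $e(ht)$ against their empirical measure
gives exactly $|\frac1N\sum_i e(hx_i)|^2$, so every nontrivial Weyl sum is $o(N)$
(`tendsto_weylSum`), and Weyl's criterion concludes. -/

/-! ### Counting tuples and removing distinctness. -/

lemma ncard_tuples_eq_sum_prod {n : ℕ} {α : Type*} [Fintype α] (P : Fin n → α → α → Prop) :
    {i : Fin (n + 1) → α | ∀ j : Fin n, P j (i 0) (i j.succ)}.ncard
      = ∑ i₀ : α, ∏ j : Fin n, {l : α | P j i₀ l}.ncard := by
  let e : {i : Fin (n + 1) → α | ∀ j : Fin n, P j (i 0) (i j.succ)} ≃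
      (Σ i₀ : α, ∀ j : Fin n, {l : α | P j i₀ l}) :=
    { toFun := fun i => ⟨i.1 0, fun j => ⟨i.1 j.succ, i.2 j⟩⟩
      invFun := fun p => ⟨Fin.cons p.1 (fun j => (p.2 j).1), fun j => by
        have := (p.2 j).2
        rw [Set.mem_ofPred_eq] at this
        simpa only [Fin.cons_zero, Fin.cons_succ] using this⟩
      left_inv := fun i => by
        ext j
        refine Fin.cases ?_ (fun j => ?_) j <;> simp
      right_inv := fun p => rfl }
  rw [← Nat.card_coe_set_eq, Nat.card_congr e, Nat.card_sigma]
  simp [Nat.card_pi]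

lemma ncard_injective_tuples (N k : ℕ) :
    {i : Fin k → Fin N | Function.Injective i}.ncard = N.descFactorial k := by
  rw [← Nat.card_coe_set_eq]
  have e := Equiv.subtypeInjectiveEquivEmbedding (Fin k) (Fin N)
  have := Nat.card_congr e
  exact this.trans (by simp [Nat.card_eq_fintype_card])

lemma tendsto_descFactorial_div_pow (k : ℕ) :
    Tendsto (fun N : ℕ => (N.descFactorial k : ℝ) / (N : ℝ) ^ k) atTop (𝓝 1) := by
  induction k with
  | zero => simp
  | succ k ih =>
    have h : Tendsto (fun N : ℕ => 1 - (k : ℝ) / (N : ℝ)) atTop (𝓝 (1 - 0)) :=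
      tendsto_const_nhds.sub (tendsto_const_div_atTop_nhds_zero_nat _)
    have := h.mul ih
    rw [sub_zero, mul_one] at this
    refine this.congr' ?_
    filter_upwards [eventually_ge_atTop (k + 1)] with N hN
    have hN' : (N : ℝ) ≠ 0 := by
      have : 0 < N := by omega
      positivity
    rw [Nat.descFactorial_succ, Nat.cast_mul, Nat.cast_sub (by omega)]
    field_simp
    ring

/-- The tuples lost from `S` are non-injective, and there are only `N ^ k - N.descFactorial k` of
those. -/
lemma abs_ncard_injective_inter_div_sub_le {N k : ℕ} (S : Set (Fin k → Fin N)) :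
    |(({i | Function.Injective i ∧ i ∈ S}.ncard : ℝ)) / (N : ℝ) ^ k - (S.ncard : ℝ) / (N : ℝ) ^ k|
      ≤ ((N : ℝ) ^ k - N.descFactorial k) / (N : ℝ) ^ k := by
  have h1 : {i | Function.Injective i ∧ i ∈ S}.ncard ≤ S.ncard :=
    Set.ncard_le_ncard (fun i hi => hi.2) (Set.toFinite _)
  have h2 : S.ncard + N.descFactorial k ≤ {i | Function.Injective i ∧ i ∈ S}.ncard + N ^ k := by
    rw [← ncard_injective_tuples N k]
    have h3 := Set.ncard_union_add_ncard_inter S {i : Fin k → Fin N | Function.Injective i}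
    have h4 : (S ∪ {i : Fin k → Fin N | Function.Injective i}).ncard ≤ N ^ k := by
      refine (Set.ncard_le_ncard (Set.subset_univ _) (Set.toFinite _)).trans ?_
      simp [Set.ncard_univ]
    have h5 : S ∩ {i : Fin k → Fin N | Function.Injective i}
        = {i | Function.Injective i ∧ i ∈ S} := by
      ext i; simp [and_comm]
    rw [h5] at h3
    omega
  rw [← sub_div, abs_div, abs_of_nonneg (a := (N : ℝ) ^ k) (by positivity)]
  refine div_le_div_of_nonneg_right ?_ (by positivity)
  have h1' : (({i | Function.Injective i ∧ i ∈ S}.ncard : ℝ)) ≤ S.ncard := by exact_mod_cast h1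
  have h2' : (S.ncard : ℝ) + N.descFactorial k
    ≤ ({i | Function.Injective i ∧ i ∈ S}.ncard : ℝ) + (N : ℝ) ^ k := by exact_mod_cast h2
  rw [abs_le]
  constructor <;> linarith

/-- The proportion of `l < N` with `((y - x_l)) ∈ [a, b]`. -/
noncomputable def diffFreq (x : ℕ → ℝ) (N : ℕ) (y a b : ℝ) : ℝ :=
  ({l : Fin N | signedDistModOne (y - x l) ∈ Set.Icc a b}.ncard : ℝ) / N

/-- Distinctness of the indices does not affect the limiting behaviour of the correlations. -/
lemma tendsto_correlation_iff (x : ℕ → ℝ) (n : ℕ) (a b : Fin n → ℝ) (L : ℝ) :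
    Tendsto (fun N : ℕ => correlation x (n + 1) 0 (Set.Icc a b) N) atTop (𝓝 L) ↔
      Tendsto (fun N : ℕ => (∑ i : Fin N, ∏ j, diffFreq x N (x i) (a j) (b j)) / N)
        atTop (𝓝 L) := by
  have key : Tendsto (fun N : ℕ => correlation x (n + 1) 0 (Set.Icc a b) N -
      (∑ i : Fin N, ∏ j, diffFreq x N (x i) (a j) (b j)) / N) atTop (𝓝 0) := by
    have h0 : Tendsto (fun N : ℕ =>
        ((N : ℝ) ^ (n + 1) - N.descFactorial (n + 1)) / (N : ℝ) ^ (n + 1)) atTop (𝓝 0) := by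
      have := (tendsto_const_nhds (x := (1 : ℝ))).sub (tendsto_descFactorial_div_pow (n + 1))
      rw [sub_self] at this
      refine this.congr' ?_
      filter_upwards [eventually_gt_atTop 0] with N hN
      have : (N : ℝ) ≠ 0 := by positivity
      field_simp
    refine squeeze_zero_norm (fun N => ?_) h0
    have := abs_ncard_injective_inter_div_sub_le (N := N) (k := n + 1)
      {i | ∀ j : Fin n, signedDistModOne (x (i 0) - x (i j.succ)) ∈ Set.Icc (a j) (b j)}
    rw [ncard_tuples_eq_sum_prod (fun (j : Fin n) (i l : Fin N) =>
      signedDistModOne (x i - x l) ∈ Set.Icc (a j) (b j))] at this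
    rw [Real.norm_eq_abs]
    convert this using 3
    · unfold correlation
      congr 1
      · congr 1
        simp [Set.mem_Icc, Pi.le_def, forall_and]
      · rw [mul_zero, sub_zero, Real.rpow_natCast]
    · simp only [diffFreq, Finset.prod_div_distrib, ← Finset.sum_div, Finset.prod_const,
        Finset.card_univ, Fintype.card_fin, Nat.cast_sum, Nat.cast_prod]
      rw [pow_succ, div_div]
  constructor
  · intro h; simpa using h.sub key
  · intro h; simpa using h.add key

/-! ### Uniform distribution implies Poissonian correlations. -/

lemma exists_int_sub_eq_signedDistModOne (t : ℝ) : ∃ n : ℤ, signedDistModOne t = t - n := by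
  unfold signedDistModOne
  split_ifs
  · exact ⟨⌊t⌋, rfl⟩
  · exact ⟨⌊t⌋ + 1, by push_cast; rw [Int.fract]; ring⟩

lemma signedDistModOne_mem (t : ℝ) : signedDistModOne t ∈ Set.Ioc (-(1 / 2) : ℝ) (1 / 2) := by
  unfold signedDistModOne
  have := Int.fract_nonneg t
  have := Int.fract_lt_one t
  split_ifs <;> constructor <;> linarith

/-- Bounds how many cells $[m/M,(m+1)/M]$ meet an arc, after scaling by `M`; the `- 1` admits a cell
starting just before the arc. Reduction mod `M` recovers `m` from `m + f m * M`, so the cells inject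
into the integers of $[u-1,v]$. -/
lemma card_le_of_exists_int {M : ℕ} {u v : ℝ} (huv : u ≤ v)
    (S : Finset ℕ) (hS : ∀ m ∈ S, m < M ∧ ∃ n : ℤ, u - 1 ≤ (m : ℝ) + n * M ∧ (m : ℝ) + n * M ≤ v) :
    (S.card : ℝ) ≤ v - u + 2 := by
  choose! f hf using fun m hm => (hS m hm).2
  have hcard : S.card ≤ (Finset.Icc ⌈u - 1⌉ ⌊v⌋).card := by
    refine Finset.card_le_card_of_injOn (fun m => (m : ℤ) + f m * M) (fun m hm => ?_) ?_
    · rw [Finset.mem_coe, Finset.mem_Icc, Int.ceil_le, Int.le_floor]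
      exact_mod_cast hf m hm
    · intro m hm m' hm' h
      have h1 := (hS m hm).1
      have h2 := (hS m' hm').1
      have h3 : ((m : ℤ) + f m * M) % M = ((m' : ℤ) + f m' * M) % M := congrArg (· % (M : ℤ)) h
      rw [Int.add_mul_emod_self_right, Int.add_mul_emod_self_right] at h3
      rw [Int.emod_eq_of_lt (by positivity) (by exact_mod_cast h1),
        Int.emod_eq_of_lt (by positivity) (by exact_mod_cast h2)] at h3
      exact_mod_cast h3
  rw [Int.card_Icc] at hcard
  have h1 : ((⌊v⌋ + 1 - ⌈u - 1⌉).toNat : ℝ) ≤ v - u + 2 := by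
    rcases le_total 0 (⌊v⌋ + 1 - ⌈u - 1⌉) with h | h
    · have : (((⌊v⌋ + 1 - ⌈u - 1⌉).toNat : ℤ) : ℝ) = ((⌊v⌋ + 1 - ⌈u - 1⌉ : ℤ) : ℝ) := by
        rw [Int.toNat_of_nonneg h]
      rw [Int.cast_natCast] at this
      rw [this]
      push_cast
      have := Int.floor_le v
      have := Int.le_ceil (u - 1)
      linarith
    · rw [Int.toNat_of_nonpos h]
      push_cast
      linarith
  exact le_trans (by exact_mod_cast hcard) h1

lemma exists_cell {M : ℕ} (hM : 0 < M) {t : ℝ} (ht : t ∈ Set.Icc (0 : ℝ) 1) :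
    ∃ m < M, t ∈ Set.Icc ((m : ℝ) / M) ((m + 1 : ℝ) / M) := by
  have hM' : (0 : ℝ) < M := by exact_mod_cast hM
  rcases ht.2.eq_or_lt with rfl | h1
  · refine ⟨M - 1, by omega, ?_⟩
    rw [Nat.cast_sub (by omega)]
    constructor
    · rw [div_le_one hM']; simp
    · rw [le_div_iff₀ hM']; simp
  · have h0 : 0 ≤ t * M := mul_nonneg ht.1 hM'.le
    refine ⟨⌊t * M⌋₊, ?_, ?_, ?_⟩
    · rw [Nat.floor_lt h0]; nlinarith
    · rw [div_le_iff₀ hM']; exact Nat.floor_le h0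
    · rw [le_div_iff₀ hM']; exact (Nat.lt_floor_add_one _).le

/-- For a uniformly distributed sequence, the proportion of terms in an arc of the circle is
eventually at most the length of the arc plus `ε`, uniformly in the arc. -/
lemma UniformlyDistributed.eventually_arc_le {x : ℕ → ℝ} (hu : UniformlyDistributed x)
    (hx : ∀ n, x n ∈ Set.Icc (0 : ℝ) 1) {ε : ℝ} (hε : 0 < ε) :
    ∀ᶠ N : ℕ in atTop, ∀ y a b : ℝ, a ≤ b → b ≤ a + 1 →
      ({i : Fin N | ∃ n : ℤ, y - x i - n ∈ Set.Icc a b}.ncard : ℝ) / N ≤ b - a + ε := by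
  -- The final error is $(2+(b-a)+2/M)/M$, at most $5/M$ since $b-a\le1\le M$.
  obtain ⟨M, hM⟩ := exists_nat_gt (5 / ε)
  have hM' : (0 : ℝ) < M := lt_trans (by positivity) hM
  have hM0 : 0 < M := by exact_mod_cast hM'
  have hM1 : (1 : ℝ) ≤ M := by exact_mod_cast hM0
  -- Only `M` fixed cells are controlled, and every arc is covered by some of them; this is the
  -- source of uniformity in the arc.
  have hcell : ∀ᶠ N : ℕ in atTop, ∀ m ∈ Finset.range M,
      ({i : Fin N | x i ∈ Set.Icc ((m : ℝ) / M) ((m + 1 : ℝ) / M)}.ncard : ℝ) / N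
        ≤ 1 / M + 1 / (M : ℝ) ^ 2 := by
    rw [Filter.eventually_all_finset]
    intro m hm
    have hm' : (m : ℝ) + 1 ≤ M := by exact_mod_cast Finset.mem_range.mp hm
    have := hu ((m : ℝ) / M) ((m + 1 : ℝ) / M) (by positivity)
      (by gcongr; linarith) (by rw [div_le_one hM']; exact hm')
    have h2 : ((m + 1 : ℝ) / M) - (m : ℝ) / M < 1 / M + 1 / (M : ℝ) ^ 2 := by
      rw [← sub_div, add_sub_cancel_left]
      have : 0 < 1 / (M : ℝ) ^ 2 := by positivity
      linarith
    exact (this.eventually_lt_const h2).mono fun N h => h.le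
  filter_upwards [hcell] with N hN y a b hab hab1
  classical
  let S := (Finset.range M).filter fun m : ℕ =>
    ∃ n : ℤ, M * (y - b) - 1 ≤ (m : ℝ) + n * M ∧ (m : ℝ) + n * M ≤ M * (y - a)
  have hS : (S.card : ℝ) ≤ M * (y - a) - M * (y - b) + 2 := by
    refine card_le_of_exists_int (M := M) (by gcongr) S fun m hm => ?_
    simpa [S] using hm
  have hsub : {i : Fin N | ∃ n : ℤ, y - x i - n ∈ Set.Icc a b} ⊆
      ⋃ m ∈ S, {i : Fin N | x i ∈ Set.Icc ((m : ℝ) / M) ((m + 1 : ℝ) / M)} := by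
    rintro i ⟨n, hn1, hn2⟩
    obtain ⟨m, hm, hmem⟩ := exists_cell hM0 (hx i)
    have h1 := hmem.1
    have h2 := hmem.2
    rw [div_le_iff₀ hM'] at h1
    rw [le_div_iff₀ hM'] at h2
    refine Set.mem_biUnion (x := m) ?_ hmem
    simp only [S, Finset.coe_filter, Set.mem_ofPred_eq, Finset.mem_range]
    refine ⟨hm, n, ?_, ?_⟩ <;> nlinarith
  have hle : ({i : Fin N | ∃ n : ℤ, y - x i - n ∈ Set.Icc a b}.ncard : ℝ) / N ≤
      ∑ m ∈ S, ({i : Fin N | x i ∈ Set.Icc ((m : ℝ) / M) ((m + 1 : ℝ) / M)}.ncard : ℝ) / N := by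
    rw [← Finset.sum_div]
    gcongr
    exact_mod_cast (Set.ncard_le_ncard hsub (Set.toFinite _)).trans (Finset.set_ncard_biUnion_le _ _)
  calc _ ≤ _ := hle
    _ ≤ ∑ m ∈ S, (1 / M + 1 / (M : ℝ) ^ 2) :=
      Finset.sum_le_sum fun m hm => hN m (Finset.filter_subset _ _ hm)
    _ = S.card * (1 / M + 1 / (M : ℝ) ^ 2) := by rw [Finset.sum_const, nsmul_eq_mul]
    _ ≤ (M * (y - a) - M * (y - b) + 2) * (1 / M + 1 / (M : ℝ) ^ 2) := by gcongr
    _ = (b - a) + (2 + (b - a) + 2 / M) / M := by field_simp; ring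
    _ ≤ (b - a) + 5 / M := by
      have : 2 / (M : ℝ) ≤ 2 := by rw [div_le_iff₀ hM']; linarith
      gcongr
      linarith
    _ ≤ b - a + ε := by
      have : 5 / (M : ℝ) < ε := by rwa [div_lt_comm₀ hM' hε]
      linarith

/-- The upper bound for arcs, applied to the complementary arc $[b,a+1]$, also yields the lower
bound. -/
lemma UniformlyDistributed.eventually_abs_diffFreq_sub_le {x : ℕ → ℝ}
    (hu : UniformlyDistributed x) (hx : ∀ n, x n ∈ Set.Icc (0 : ℝ) 1) {a b : ℝ} (hab : a ≤ b)
    (ha : -(1 / 2) ≤ a) (hb : b ≤ 1 / 2) {ε : ℝ} (hε : 0 < ε) :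
    ∀ᶠ N : ℕ in atTop, ∀ y : ℝ, |diffFreq x N y a b - (b - a)| ≤ ε := by
  filter_upwards [hu.eventually_arc_le hx hε, eventually_gt_atTop 0] with N hN hN0 y
  have hN' : (0 : ℝ) < N := by exact_mod_cast hN0
  have h1 := hN y a b hab (by linarith)
  have h2 := hN y b (a + 1) (by linarith) (by linarith)
  have h3 : diffFreq x N y a b ≤
      ({i : Fin N | ∃ n : ℤ, y - x i - n ∈ Set.Icc a b}.ncard : ℝ) / N := by
    unfold diffFreq
    refine div_le_div_of_nonneg_right (Nat.cast_le.mpr ?_) hN'.le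
    refine Set.ncard_le_ncard (fun i h => ?_) (Set.toFinite _)
    obtain ⟨n, hn⟩ := exists_int_sub_eq_signedDistModOne (y - x i)
    exact ⟨n, hn ▸ h⟩
  have h4 : 1 ≤ diffFreq x N y a b +
      ({i : Fin N | ∃ n : ℤ, y - x i - n ∈ Set.Icc b (a + 1)}.ncard : ℝ) / N := by
    unfold diffFreq
    rw [← add_div, le_div_iff₀ hN', one_mul]
    have hsub : (Set.univ : Set (Fin N)) ⊆ {l | signedDistModOne (y - x l) ∈ Set.Icc a b} ∪
        {i | ∃ n : ℤ, y - x i - n ∈ Set.Icc b (a + 1)} := by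
      intro i _
      obtain ⟨n, hn⟩ := exists_int_sub_eq_signedDistModOne (y - x i)
      have hm := signedDistModOne_mem (y - x i)
      by_cases h5 : signedDistModOne (y - x i) < a
      · right
        refine ⟨n - 1, ?_, ?_⟩ <;> push_cast <;> linarith [hm.1]
      · by_cases h6 : b < signedDistModOne (y - x i)
        · right
          refine ⟨n, ?_, ?_⟩ <;> linarith [hm.2]
        · left
          exact ⟨not_lt.mp h5, not_lt.mp h6⟩
    have := (Set.ncard_le_ncard hsub (Set.toFinite _)).trans (Set.ncard_union_le _ _)
    rw [Set.ncard_univ, Nat.card_eq_fintype_card, Fintype.card_fin] at this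
    exact_mod_cast this
  rw [abs_le]
  constructor <;> linarith

lemma diffFreq_mem_Icc (x : ℕ → ℝ) (N : ℕ) (y a b : ℝ) :
    diffFreq x N y a b ∈ Set.Icc (0 : ℝ) 1 := by
  unfold diffFreq
  refine ⟨by positivity, div_le_one_of_le₀ ?_ (by positivity)⟩
  exact_mod_cast (Set.ncard_le_ncard (Set.subset_univ _) (Set.toFinite _)).trans
    (by simp [Set.ncard_univ])

/-- Factors are exchanged one at a time; all the others have absolute value at most 1. -/
lemma abs_prod_sub_prod_le_sum {ι : Type*} (s : Finset ι) (f g : ι → ℝ)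
    (hf : ∀ i ∈ s, f i ∈ Set.Icc (0 : ℝ) 1) (hg : ∀ i ∈ s, g i ∈ Set.Icc (0 : ℝ) 1) :
    |∏ i ∈ s, f i - ∏ i ∈ s, g i| ≤ ∑ i ∈ s, |f i - g i| := by
  classical
  induction s using Finset.induction_on with
  | empty => simp
  | insert j s hj ih =>
    rw [Finset.prod_insert hj, Finset.prod_insert hj, Finset.sum_insert hj]
    have ih := ih (fun i hi => hf i (Finset.mem_insert_of_mem hi))
      (fun i hi => hg i (Finset.mem_insert_of_mem hi))
    have hfj := hf j (Finset.mem_insert_self _ _)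
    have h1 : |∏ i ∈ s, g i| ≤ 1 := by
      rw [abs_of_nonneg (Finset.prod_nonneg fun i hi => (hg i (Finset.mem_insert_of_mem hi)).1)]
      exact Finset.prod_le_one (fun i hi => (hg i (Finset.mem_insert_of_mem hi)).1)
        (fun i hi => (hg i (Finset.mem_insert_of_mem hi)).2)
    calc _ = |f j * (∏ i ∈ s, f i - ∏ i ∈ s, g i) + (f j - g j) * ∏ i ∈ s, g i| := by ring_nf
      _ ≤ |f j| * |∏ i ∈ s, f i - ∏ i ∈ s, g i| + |f j - g j| * |∏ i ∈ s, g i| := by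
        rw [← abs_mul, ← abs_mul]; exact abs_add_le _ _
      _ ≤ 1 * |∏ i ∈ s, f i - ∏ i ∈ s, g i| + |f j - g j| * 1 := by
        gcongr
        rw [abs_of_nonneg hfj.1]; exact hfj.2
      _ ≤ _ := by linarith

lemma UniformlyDistributed.tendsto_correlation {x : ℕ → ℝ} (hu : UniformlyDistributed x)
    (hx : ∀ n, x n ∈ Set.Icc (0 : ℝ) 1) {n : ℕ} {a b : Fin n → ℝ} (hab : ∀ j, a j ≤ b j)
    (ha : ∀ j, -(1 / 2) ≤ a j) (hb : ∀ j, b j ≤ 1 / 2) :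
    Tendsto (fun N : ℕ => correlation x (n + 1) 0 (Set.Icc a b) N) atTop
      (𝓝 (∏ j, (b j - a j))) := by
  rw [tendsto_correlation_iff, Metric.tendsto_nhds]
  intro ε hε
  have hδ : 0 < ε / (n + 1) := by positivity
  have h : ∀ᶠ N : ℕ in atTop, ∀ j, ∀ y : ℝ,
      |diffFreq x N y (a j) (b j) - (b j - a j)| ≤ ε / (n + 1) := by
    rw [Filter.eventually_all]
    exact fun j => hu.eventually_abs_diffFreq_sub_le hx (hab j) (ha j) (hb j) hδ
  filter_upwards [h, eventually_gt_atTop 0] with N hN hN0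
  have hN' : (0 : ℝ) < N := by exact_mod_cast hN0
  have hi : ∀ y, |∏ j, diffFreq x N y (a j) (b j) - ∏ j, (b j - a j)| ≤ n * (ε / (n + 1)) := by
    intro y
    refine (abs_prod_sub_prod_le_sum _ _ _ (fun j _ => diffFreq_mem_Icc ..)
      (fun j _ => ⟨by linarith [hab j], by linarith [ha j, hb j]⟩)).trans ?_
    refine (Finset.sum_le_sum fun j _ => hN j y).trans ?_
    simp
  rw [Real.dist_eq]
  have heq : (∑ i : Fin N, ∏ j, diffFreq x N (x i) (a j) (b j)) / N - ∏ j, (b j - a j) =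
      (∑ i : Fin N, (∏ j, diffFreq x N (x i) (a j) (b j) - ∏ j, (b j - a j))) / N := by
    rw [Finset.sum_sub_distrib, sub_div]
    simp [hN'.ne']
  rw [heq, abs_div, abs_of_pos hN', div_lt_iff₀ hN']
  calc _ ≤ ∑ i : Fin N, |∏ j, diffFreq x N (x i) (a j) (b j) - ∏ j, (b j - a j)| :=
        Finset.abs_sum_le_sum_abs _ _
    _ ≤ ∑ i : Fin N, n * (ε / (n + 1)) := Finset.sum_le_sum fun i _ => hi _
    _ = N * (n * (ε / (n + 1))) := by simp
    _ < ε * N := by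
      have : n * (ε / (n + 1)) < ε := by
        rw [← mul_div_assoc, div_lt_iff₀ (by positivity)]; nlinarith
      nlinarith

/-! ### Empirical measures, weak convergence and Weyl sums. -/

section Empirical

variable {ι E : Type*} [Fintype ι] [Nonempty ι] [MeasurableSpace E]

/-- The empirical probability measure of a finite family of points. -/
noncomputable def empiricalMeasure (f : ι → E) : ProbabilityMeasure E :=
  ⟨(Fintype.card ι : ENNReal)⁻¹ • ∑ i, Measure.dirac (f i), ⟨by
    simp [ENNReal.inv_mul_cancel]⟩⟩

lemma coe_empiricalMeasure (f : ι → E) : (empiricalMeasure f : Measure E) =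
    (Fintype.card ι : ENNReal)⁻¹ • ∑ i, Measure.dirac (f i) := rfl

lemma integral_empiricalMeasure [MeasurableSingletonClass E] (f : ι → E) (g : E → ℂ) :
    ∫ t, g t ∂(empiricalMeasure f : Measure E) = (∑ i, g (f i)) / Fintype.card ι := by
  rw [coe_empiricalMeasure, integral_smul_measure, integral_finsetSum_measure]
  · simp [integral_dirac, div_eq_inv_mul]
  · intro i _
    exact integrable_dirac (by simp)

lemma measureReal_empiricalMeasure (f : ι → E) {s : Set E} (hs : MeasurableSet s) :
    (empiricalMeasure f : Measure E).real s = ({i | f i ∈ s}.ncard : ℝ) / Fintype.card ι := by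
  classical
  rw [coe_empiricalMeasure, measureReal_def]
  simp only [Measure.smul_apply, Measure.coe_finsetSum, Finset.sum_apply,
    Measure.dirac_apply' _ hs, smul_eq_mul, ENNReal.toReal_mul, ENNReal.toReal_inv,
    ENNReal.toReal_natCast]
  rw [div_eq_inv_mul, Set.ncard_eq_toFinset_card']
  congr 1
  simp [Set.indicator_apply]

end Empirical

/-- The uniform distribution on `[-1/2, 1/2]`. -/
noncomputable def uniformSymmUnit : ProbabilityMeasure ℝ :=
  ⟨volume.restrict (Set.Icc (-(1 / 2)) (1 / 2)), ⟨by simp; norm_num⟩⟩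

/-- Closed intervals form a π-system containing small neighbourhoods of every point, so convergence
on them gives weak convergence. The support condition lets any interval be cut down to
$[-\tfrac12,\tfrac12]$. -/
lemma tendsto_uniformSymmUnit {μ : ℕ → ProbabilityMeasure ℝ}
    (hsupp : ∀ n, (μ n : Measure ℝ).real (Set.Icc (-(1 / 2)) (1 / 2))ᶜ = 0)
    (h : ∀ a b : ℝ, -(1 / 2) ≤ a → a ≤ b → b ≤ 1 / 2 →
      Tendsto (fun n => (μ n : Measure ℝ).real (Set.Icc a b)) atTop (𝓝 (b - a))) :
    Tendsto μ atTop (𝓝 uniformSymmUnit) := by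
  refine IsPiSystem.tendsto_probabilityMeasure_of_tendsto_of_mem
    (S := {s | ∃ a b : ℝ, s = Set.Icc a b}) ?_ ?_ ?_ ?_
  · rintro _ ⟨a, b, rfl⟩ _ ⟨c, d, rfl⟩ -
    exact ⟨_, _, Set.Icc_inter_Icc⟩
  · rintro _ ⟨a, b, rfl⟩
    exact measurableSet_Icc
  · intro u hu x hx
    obtain ⟨ε, hε, hball⟩ := Metric.nhds_basis_closedBall.mem_iff.mp (hu.mem_nhds hx)
    exact ⟨_, ⟨_, _, Real.closedBall_eq_Icc⟩, Metric.closedBall_mem_nhds x hε, hball⟩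
  · rintro _ ⟨a, b, rfl⟩
    rw [← NNReal.tendsto_coe]
    simp only [← ProbabilityMeasure.measureReal_eq_coe_coeFn]
    have h1 : ∀ n, (μ n : Measure ℝ).real (Set.Icc a b) =
        (μ n : Measure ℝ).real (Set.Icc (max a (-(1 / 2))) (min b (1 / 2))) := by
      intro n
      rw [← Set.Icc_inter_Icc]
      refine le_antisymm ?_ (measureReal_mono Set.inter_subset_left)
      have := measureReal_union_le (μ := (μ n : Measure ℝ))
        (Set.Icc a b ∩ Set.Icc (-(1 / 2)) (1 / 2)) (Set.Icc (-(1 / 2)) (1 / 2))ᶜ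
      rw [hsupp, add_zero] at this
      refine le_trans (measureReal_mono fun t ht => ?_) this
      by_cases h : t ∈ Set.Icc (-(1 / 2) : ℝ) (1 / 2)
      · exact Or.inl ⟨ht, h⟩
      · exact Or.inr h
    have h2 : (uniformSymmUnit : Measure ℝ).real (Set.Icc a b) =
        volume.real (Set.Icc (max a (-(1 / 2))) (min b (1 / 2))) := by
      rw [← Set.Icc_inter_Icc]
      exact measureReal_restrict_apply measurableSet_Icc
    rw [h2]
    simp only [h1]
    rcases le_or_gt (max a (-(1 / 2))) (min b (1 / 2)) with hle | hlt
    · rw [Real.volume_real_Icc_of_le hle]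
      exact h _ _ (le_max_right _ _) hle (min_le_right _ _)
    · rw [Set.Icc_eq_empty (not_le.mpr hlt)]
      simp

lemma fourier_signedDistModOne (h : ℤ) (t : ℝ) :
    fourier h ((signedDistModOne t : ℝ) : UnitAddCircle) = fourier h (t : UnitAddCircle) := by
  obtain ⟨n, hn⟩ := exists_int_sub_eq_signedDistModOne t
  congr 1
  rw [hn, AddCircle.coe_sub]
  have : ((n : ℝ) : UnitAddCircle) = 0 := by
    rw [AddCircle.coe_eq_zero_iff]
    exact ⟨n, by simp⟩
  rw [this, sub_zero]

lemma integral_fourier_eq_zero {h : ℤ} (hh : h ≠ 0) :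
    ∫ t : UnitAddCircle, fourier h t = 0 := by
  have := integral_eq_zero_of_add_right_eq_neg (μ := (volume : Measure UnitAddCircle))
    (fourier_add_half_inv_index hh one_pos)
  exact this

lemma integral_fourier_uniformSymmUnit {h : ℤ} (hh : h ≠ 0) :
    ∫ t : ℝ, fourier h (t : UnitAddCircle) ∂(uniformSymmUnit : Measure ℝ) = 0 := by
  have h1 := UnitAddCircle.intervalIntegral_preimage (-(1 / 2)) (fun t => fourier h t)
  rw [integral_fourier_eq_zero hh, intervalIntegral.integral_of_le (by norm_num),
    ← integral_Icc_eq_integral_Ioc] at h1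
  rw [show (-(1 / 2) + 1 : ℝ) = 1 / 2 by norm_num] at h1
  exact h1

/-- The differences of the terms of a sequence with Poissonian `(2, 0)`-correlations are
equidistributed, hence the Weyl sums of the sequence are small. -/
lemma tendsto_weylSum {x : ℕ → ℝ}
    (hp : ∀ a b : ℝ, -(1 / 2) ≤ a → a ≤ b → b ≤ 1 / 2 →
      Tendsto (fun N : ℕ => (∑ i : Fin N, diffFreq x N (x i) a b) / N) atTop (𝓝 (b - a)))
    {h : ℤ} (hh : h ≠ 0) :
    Tendsto (fun N : ℕ => (∑ i : Fin (N + 1), fourier h (x i : UnitAddCircle)) / ((N + 1 : ℕ) : ℂ))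
      atTop (𝓝 0) := by
  -- All pairs are used, including the diagonal; `N + 1` keeps the index type nonempty.
  let μ : ℕ → ProbabilityMeasure ℝ := fun N =>
    empiricalMeasure fun p : Fin (N + 1) × Fin (N + 1) => signedDistModOne (x p.1 - x p.2)
  have hμ : Tendsto μ atTop (𝓝 uniformSymmUnit) := by
    refine tendsto_uniformSymmUnit (fun N => ?_) (fun a b ha hab hb => ?_)
    · rw [measureReal_empiricalMeasure _ measurableSet_Icc.compl]
      have : {p : Fin (N + 1) × Fin (N + 1) | signedDistModOne (x p.1 - x p.2) ∈
          (Set.Icc (-(1 / 2) : ℝ) (1 / 2))ᶜ} = ∅ := by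
        refine Set.eq_empty_of_forall_notMem fun p hp => ?_
        exact hp (Set.Ioc_subset_Icc_self (signedDistModOne_mem _))
      rw [this, Set.ncard_empty, Nat.cast_zero, zero_div]
    · refine ((hp a b ha hab hb).comp (tendsto_add_atTop_nat 1)).congr fun N => ?_
      rw [measureReal_empiricalMeasure _ measurableSet_Icc]
      have : {p : Fin (N + 1) × Fin (N + 1) | signedDistModOne (x p.1 - x p.2) ∈
          Set.Icc a b}.ncard = ∑ i : Fin (N + 1),
            {l : Fin (N + 1) | signedDistModOne (x i - x l) ∈ Set.Icc a b}.ncard := by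
        classical
        simp only [Set.ncard_eq_toFinset_card', Set.toFinset_ofPred, Finset.card_filter,
          Fintype.sum_prod_type]
      rw [this]
      simp only [Function.comp, diffFreq, ← Finset.sum_div, Fintype.card_prod, Fintype.card_fin,
        Nat.cast_sum, Nat.cast_mul, div_div]
  have hcont : Continuous fun t : ℝ => fourier h (t : UnitAddCircle) :=
    (fourier h).continuous.comp (AddCircle.continuous_mk' 1)
  let g : BoundedContinuousFunction ℝ ℂ :=
    BoundedContinuousFunction.ofNormedAddCommGroup _ hcont 1 fun t => by rw [fourier_apply, Circle.norm_coe]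
  have hlim := (ProbabilityMeasure.tendsto_iff_forall_integral_rclike_tendsto ℂ).mp hμ g
  have hg : ∫ t, g t ∂(uniformSymmUnit : Measure ℝ) = 0 := integral_fourier_uniformSymmUnit hh
  rw [hg] at hlim
  -- Since $e(h((x_i-x_l)))=e(hx_i)\overline{e(hx_l)}$, the double sum factors into a squared
  -- modulus.
  have hsq : ∀ N, ∫ t, g t ∂(μ N : Measure ℝ) =
      ((‖(∑ i : Fin (N + 1), fourier h (x i : UnitAddCircle)) / ((N + 1 : ℕ) : ℂ)‖ ^ 2 : ℝ) : ℂ) := by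
    intro N
    rw [integral_empiricalMeasure, Complex.ofReal_pow, ← Complex.mul_conj', map_div₀, map_sum,
      div_mul_div_comm, Finset.sum_mul_sum, Fintype.sum_prod_type]
    simp only [Fintype.card_prod, Fintype.card_fin, Nat.cast_mul, Complex.conj_natCast]
    congr 1
    refine Finset.sum_congr rfl fun i _ => Finset.sum_congr rfl fun l _ => ?_
    change fourier h ((signedDistModOne (x i - x l) : ℝ) : UnitAddCircle) = _
    rw [fourier_signedDistModOne, ← fourier_neg, AddCircle.coe_sub]
    rw [fourier_apply, fourier_apply, fourier_apply, smul_sub, sub_eq_add_neg,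
      AddCircle.toCircle_add, Circle.coe_mul, neg_smul]
  simp only [hsq] at hlim
  rw [← Complex.ofReal_zero, tendsto_ofReal_iff] at hlim
  have := hlim.sqrt
  simp only [Real.sqrt_sq (norm_nonneg _), Real.sqrt_zero] at this
  exact tendsto_zero_iff_norm_tendsto_zero.mpr this

/-! ### Weyl's criterion. -/

/-- The uniform distribution on the circle `ℝ / ℤ`. -/
noncomputable def uniformUnitAddCircle : ProbabilityMeasure UnitAddCircle :=
  ⟨volume, ⟨UnitAddCircle.measure_univ⟩⟩

/-- Integrals of trigonometric polynomials converge by linearity; their uniform density in the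
continuous functions and an $\varepsilon/3$ argument give the rest. -/
lemma tendsto_empiricalMeasure_unitAddCircle {x : ℕ → ℝ}
    (hw : ∀ h : ℤ, h ≠ 0 → Tendsto (fun N : ℕ =>
      (∑ i : Fin (N + 1), fourier h (x i : UnitAddCircle)) / ((N + 1 : ℕ) : ℂ)) atTop (𝓝 0)) :
    Tendsto (fun N : ℕ => empiricalMeasure fun i : Fin (N + 1) => (x i : UnitAddCircle)) atTop
      (𝓝 uniformUnitAddCircle) := by
  rw [ProbabilityMeasure.tendsto_iff_forall_integral_rclike_tendsto ℂ]
  intro f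
  have hspan : ∀ g ∈ Submodule.span ℂ (Set.range (@fourier 1)), Tendsto (fun N : ℕ =>
      ∫ t, g t ∂(empiricalMeasure (fun i : Fin (N + 1) => (x i : UnitAddCircle)) : Measure _)) atTop
      (𝓝 (∫ t : UnitAddCircle, g t)) := by
    intro g hg
    have hint : ∀ (ν : ProbabilityMeasure UnitAddCircle) (g : C(UnitAddCircle, ℂ)),
        Integrable g (ν : Measure _) := fun ν g =>
      g.continuous.integrable_of_hasCompactSupport (HasCompactSupport.of_compactSpace _)
    have hint' : ∀ g : C(UnitAddCircle, ℂ), Integrable g :=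
      hint uniformUnitAddCircle
    induction hg using Submodule.span_induction with
    | mem g hg =>
      obtain ⟨h, rfl⟩ := hg
      rcases eq_or_ne h 0 with rfl | hh
      · simp [measureReal_def]
      · rw [integral_fourier_eq_zero hh]
        simpa only [integral_empiricalMeasure, Fintype.card_fin] using hw h hh
    | zero => simp
    | add g₁ g₂ _ _ h₁ h₂ =>
      simp only [ContinuousMap.add_apply]
      rw [integral_add (hint' _) (hint' _)]
      simp only [fun N : ℕ => integral_add (hint (empiricalMeasure
        fun i : Fin (N + 1) => (x i : UnitAddCircle)) g₁) (hint _ g₂)]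
      exact h₁.add h₂
    | smul c g _ h =>
      simp only [ContinuousMap.smul_apply, integral_smul]
      exact h.const_smul c
  have hclos : (⟨f, f.continuous⟩ : C(UnitAddCircle, ℂ)) ∈
      (Submodule.span ℂ (Set.range (@fourier 1))).topologicalClosure := by
    rw [span_fourier_closure_eq_top]; trivial
  rw [← SetLike.mem_coe, Submodule.topologicalClosure_coe, Metric.mem_closure_iff] at hclos
  rw [Metric.tendsto_nhds]
  intro ε hε
  obtain ⟨g, hg, hfg⟩ := hclos (ε / 3) (by positivity)
  have hbound : ∀ ν : ProbabilityMeasure UnitAddCircle,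
      dist (∫ t, f t ∂(ν : Measure _)) (∫ t, g t ∂(ν : Measure _)) ≤ ε / 3 := by
    intro ν
    rw [dist_eq_norm, ← integral_sub (f.integrable _)
      (g.continuous.integrable_of_hasCompactSupport (HasCompactSupport.of_compactSpace _))]
    refine (norm_integral_le_of_norm_le_const (C := ε / 3) (ae_of_all _ fun t => ?_)).trans ?_
    · rw [← dist_eq_norm]
      exact ((ContinuousMap.dist_apply_le_dist t).trans hfg.le)
    · simp
  have := Metric.tendsto_nhds.mp (hspan g hg) (ε / 3) (by positivity)
  filter_upwards [this] with N hN
  have h1 := hbound (empiricalMeasure fun i : Fin (N + 1) => (x i : UnitAddCircle))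
  have h2 := hbound uniformUnitAddCircle
  rw [dist_comm] at h2
  calc _ ≤ _ := dist_triangle4 _ _ _ _
    _ < ε / 3 + ε / 3 + ε / 3 := by
      refine add_lt_add_of_lt_of_le (add_lt_add_of_le_of_lt h1 hN) h2
    _ = ε := by ring

lemma eventually_ncard_closedBall_le {x : ℕ → ℝ}
    (hw : ∀ h : ℤ, h ≠ 0 → Tendsto (fun N : ℕ =>
      (∑ i : Fin (N + 1), fourier h (x i : UnitAddCircle)) / ((N + 1 : ℕ) : ℂ)) atTop (𝓝 0))
    (y : UnitAddCircle) {r c : ℝ} (hr : 0 ≤ r) (hc : 2 * r < c) :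
    ∀ᶠ N : ℕ in atTop,
      ({i : Fin N | (x i : UnitAddCircle) ∈ Metric.closedBall y r}.ncard : ℝ) / N < c := by
  have h1 := ProbabilityMeasure.limsup_measure_closed_le_of_tendsto
    (tendsto_empiricalMeasure_unitAddCircle hw) (Metric.isClosed_closedBall (x := y) (ε := r))
  have h2 : (volume : Measure UnitAddCircle) (Metric.closedBall y r) < ENNReal.ofReal c := by
    rw [AddCircle.volume_closedBall, ENNReal.ofReal_lt_ofReal_iff (by linarith)]
    exact min_lt_of_right_lt hc
  have h3 := eventually_lt_of_limsup_lt (h1.trans_lt h2)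
  rw [← map_add_atTop_eq_nat 1, eventually_map]
  filter_upwards [h3] with N hN
  have := measureReal_empiricalMeasure (fun i : Fin (N + 1) => (x i : UnitAddCircle))
    (Metric.isClosed_closedBall (x := y) (ε := r)).measurableSet
  rw [Fintype.card_fin] at this
  rw [← this, measureReal_def]
  exact ENNReal.toReal_lt_of_lt_ofReal hN

/-- Upper bounds for closed balls suffice: $[a,b]$ maps into the ball about its midpoint, and the
points outside it map into the antipodal ball. -/
lemma uniformlyDistributed_of_tendsto_weylSum {x : ℕ → ℝ} (hx : ∀ n, x n ∈ Set.Icc (0 : ℝ) 1)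
    (hw : ∀ h : ℤ, h ≠ 0 → Tendsto (fun N : ℕ =>
      (∑ i : Fin (N + 1), fourier h (x i : UnitAddCircle)) / ((N + 1 : ℕ) : ℂ)) atTop (𝓝 0)) :
    UniformlyDistributed x := by
  intro a b ha hab hb
  have hball : ∀ s t r : ℝ, ∀ n : ℤ, |s - n - t| ≤ r →
      (s : UnitAddCircle) ∈ Metric.closedBall (t : UnitAddCircle) r := by
    intro s t r n h
    rw [Metric.mem_closedBall, dist_eq_norm]
    have : (s : UnitAddCircle) - (t : UnitAddCircle) = ((s - n - t : ℝ) : UnitAddCircle) := by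
      have : ((n : ℝ) : UnitAddCircle) = 0 := by
        rw [AddCircle.coe_eq_zero_iff]
        exact ⟨n, by simp⟩
      rw [AddCircle.coe_sub, AddCircle.coe_sub, this, sub_zero]
    rw [this]
    rw [UnitAddCircle.norm_eq]
    exact (by simpa using round_le (s - n - t) 0 : _ ≤ |s - n - t|).trans h
  rw [tendsto_order]
  constructor
  · intro c hc
    filter_upwards [eventually_ncard_closedBall_le hw (((a + b) / 2 + 1 / 2 : ℝ) : UnitAddCircle)
      (r := (1 - (b - a)) / 2) (c := 1 - c) (by linarith) (by linarith),
      eventually_gt_atTop 0] with N hN hN0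
    have hN' : (0 : ℝ) < N := by exact_mod_cast hN0
    have hsub : (Set.univ : Set (Fin N)) ⊆ {i | x i ∈ Set.Icc a b} ∪
        {i | (x i : UnitAddCircle) ∈ Metric.closedBall
          (((a + b) / 2 + 1 / 2 : ℝ) : UnitAddCircle) ((1 - (b - a)) / 2)} := by
      intro i _
      have h0 := (hx i).1
      have h1 := (hx i).2
      by_cases h5 : x i < a
      · right
        -- The antipodal ball lifts to $[b,a+1]$, which contains $x_i+1$ when $x_i<a$.
        refine hball _ _ _ (-1) ?_
        rw [abs_le]
        push_cast
        constructor <;> linarith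
      · by_cases h6 : b < x i
        · right
          refine hball _ _ _ 0 ?_
          rw [abs_le]
          push_cast
          constructor <;> linarith
        · left
          exact ⟨not_lt.mp h5, not_lt.mp h6⟩
    have h1 := (Set.ncard_le_ncard hsub (Set.toFinite _)).trans (Set.ncard_union_le _ _)
    rw [Set.ncard_univ, Nat.card_eq_fintype_card, Fintype.card_fin] at h1
    have h2 : (N : ℝ) ≤ ({i : Fin N | x i ∈ Set.Icc a b}.ncard : ℝ) +
        ({i : Fin N | (x i : UnitAddCircle) ∈ Metric.closedBall
          (((a + b) / 2 + 1 / 2 : ℝ) : UnitAddCircle) ((1 - (b - a)) / 2)}.ncard : ℝ) := by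
      exact_mod_cast h1
    rw [div_lt_iff₀ hN'] at hN
    rw [lt_div_iff₀ hN']
    linarith
  · intro c hc
    filter_upwards [eventually_ncard_closedBall_le hw (((a + b) / 2 : ℝ) : UnitAddCircle)
      (r := (b - a) / 2) (c := c) (by linarith) (by linarith)] with N hN
    refine lt_of_le_of_lt ?_ hN
    refine div_le_div_of_nonneg_right (Nat.cast_le.mpr ?_) N.cast_nonneg
    refine Set.ncard_le_ncard (fun i h => ?_) (Set.toFinite _)
    refine hball _ _ _ 0 ?_
    rw [abs_le]
    push_cast
    constructor <;> linarith [h.1, h.2]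

/-! ### Reduction to pair correlations and conclusion. -/

lemma volume_real_Icc_pi {n : ℕ} {a b : Fin n → ℝ} (hab : ∀ j, a j ≤ b j) :
    volume.real (Set.Icc a b) = ∏ j, (b j - a j) := by
  rw [measureReal_def, Real.volume_Icc_pi_toReal (fun j => hab j)]

lemma diffFreq_full (x : ℕ → ℝ) {N : ℕ} (hN : 0 < N) (y : ℝ) :
    diffFreq x N y (-(1 / 2)) (1 / 2) = 1 := by
  have : {l : Fin N | signedDistModOne (y - x l) ∈ Set.Icc (-(1 / 2) : ℝ) (1 / 2)} = Set.univ :=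
    Set.eq_univ_of_forall fun l => Set.Ioc_subset_Icc_self (signedDistModOne_mem _)
  rw [diffFreq, this, Set.ncard_univ]
  simp [hN.ne']

/-- Full sides $[-\tfrac12,\tfrac12]$ impose no condition and have length 1, so only the first
coordinate matters. -/
lemma tendsto_pairFreq {x : ℕ → ℝ} {m : ℕ} (hp : PoissonianZeroCorrelations x (m + 2)) (a b : ℝ)
    (ha : -(1 / 2) ≤ a) (hab : a ≤ b) (hb : b ≤ 1 / 2) :
    Tendsto (fun N : ℕ => (∑ i : Fin N, diffFreq x N (x i) a b) / N) atTop (𝓝 (b - a)) := by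
  let A : Fin (m + 1) → ℝ := Fin.cons a fun _ => -(1 / 2)
  let B : Fin (m + 1) → ℝ := Fin.cons b fun _ => 1 / 2
  have hAB : ∀ j, A j ≤ B j := Fin.cases hab fun j => by simp only [A, B, Fin.cons_succ]; norm_num
  have h := hp A B hAB (Fin.cases ha fun j => le_of_eq (by simp [A]))
    (Fin.cases hb fun j => le_of_eq (by simp [B]))
  have hv : volume.real (Set.Icc A B) = b - a := by
    rw [volume_real_Icc_pi hAB, Fin.prod_univ_succ]
    simp only [A, B, Fin.cons_zero, Fin.cons_succ]
    norm_num
  have h' : Tendsto (fun N : ℕ => correlation x (m + 1 + 1) 0 (Set.Icc A B) N) atTop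
      (𝓝 (b - a)) := hv ▸ h
  rw [tendsto_correlation_iff] at h'
  refine h'.congr' ?_
  filter_upwards [eventually_gt_atTop 0] with N hN
  congr 1
  refine Finset.sum_congr rfl fun i _ => ?_
  rw [Fin.prod_univ_succ]
  simp only [A, B, Fin.cons_zero, Fin.cons_succ, diffFreq_full x hN, Finset.prod_const_one, mul_one]

theorem theorem7 (k : ℕ) (hk : 2 ≤ k) (x : ℕ → ℝ) (hx : ∀ n, x n ∈ Set.Icc (0 : ℝ) 1) :
    UniformlyDistributed x ↔ PoissonianZeroCorrelations x k := by
  obtain ⟨m, rfl⟩ := Nat.exists_eq_add_of_le' hk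
  constructor
  · intro hu a b hab ha hb
    rw [volume_real_Icc_pi hab]
    exact hu.tendsto_correlation hx hab ha hb
  · intro hp
    exact uniformlyDistributed_of_tendsto_weylSum hx fun h hh =>
      tendsto_weylSum (tendsto_pairFreq hp) hh
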